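/- Let $\Omega\subset\mathbb{R}^2$ be a bounded open set (for instance a bounded domain with Lipschitz-continuous boundary), let $H^1_0(\Omega)$ be the closure of $C_c^\infty(\Omega)$ in $H^1(\Omega)$, let $V=\{v\in H_0^1(\Omega)^2:\operatorname{div}v=0\}$ and $L^2_0(\Omega)=\{q\in L^2(\Omega):\int_\Omega q=0\}$, let $\|\cdot\|$ be the norm of $L^2(\Omega)$ or $L^2(\Omega)^2$, and let $\|v\|_\alpha^2=\|v\|^2+\alpha\|\nabla v\|^2$. For a scalar $z$ and a plane vector $w$ write $z\times w=(-z w_2,z w_1)$, and $\operatorname{curl}w=\partial_1w_2-\partial_2w_1$. There is a constant $C>0$, depending only on $\Omega$, with the following property. Let $\alpha\ge 0$, $\nu>0$, $T>0$, $f\in L^2(0,T;H(\operatorname{curl};\Omega))$ and $u_0,h_0\in V$ with $\operatorname{curl}(u_0-\alpha\Delta u_0)\in L^2(\Omega)$. Let $N\ge1$ be an integer, $k=T/N$, $t^n=nk$ and $f^n=\frac1k\int_{t^{n-1}}^{t^n}f(\cdot,s)\,ds$. Put $u^0=u_0$, $h^0=h_0$, $z^0=\operatorname{curl}(u_0-\alpha\Delta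 u_0)$, and let $u^n,h^n\in V$, $z^n\in L^2(\Omega)$, $p^n,\omega^n\in L^2_0(\Omega)$ $(1\le n\le N)$ be any solution of the semi-discrete scheme, for $0\le n\le N-1$ and in the sense of distributions on $\Omega$, \[ \begin{aligned} &\tfrac1k(u^{n+1}-u^n)-\tfrac{\alpha}{k}\Delta(u^{n+1}-u^n)-\nu\Delta u^{n+1}+z^n\times u^{n+1}=f^{n+1}+h^{n+1}\cdot\nabla h^{n+1}-\nabla\bigl(p^{n+1}+|h^{n+1}|^2\bigr),\\ &\tfrac1k(h^{n+1}-h^n)-\Delta h^{n+1}+u^{n+1}\cdot\nabla h^{n+1}-h^{n+1}\cdot\nabla u^{n+1}=-\nabla\omega^{n+1},\\ &\tfrac{\alpha}{k}(z^{n+1}-z^n)+\nu z^{n+1}+\alpha\,u^{n+1}\cdot\nabla z^{n+1}=\nu\operatorname{curl}u^{n+1}+\alpha\operatorname{curl}f^{n+1}+\alpha\operatorname{curl}(h^{n+1}\cdot\nabla h^{n+1})-\alpha\operatorname{curl}\nabla\bigl(p^{n+1}+|h^{n+1}|^2\bigr). \end{aligned} \] Then, for all $1\le n\le N$, \[ \|u^n\|_\alpha^2+\sum_{i=0}^{n-1}\|u^{i+1}-u^i\|_\alpha^2\le\frac{C^2}{2\nu}\|f\|^2_{L^2(\Omega\times(0,t^n))}+\|u_0\|_\alpha^2+\|h_0\|^2,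 \] \[ \|h^n\|^2+\sum_{i=0}^{n-1}\|h^{i+1}-h^i\|^2\le\frac{C^2}{2\nu}\|f\|^2_{L^2(\Omega\times(0,t^n))}+\|u_0\|_\alpha^2+\|h_0\|^2. \] -/

import Mathlib

open MeasureTheory Filter Topology
open scoped ContDiff ENNReal

noncomputable section

namespace GradeTwoMHD

/-- The Euclidean plane. -/
abbrev Plane : Type := EuclideanSpace ℝ (Fin 2)

/-- The classical partial derivative of a scalar function in the direction of the `i`-th axis. -/
def pd (i : Fin 2) (φ : Plane → ℝ) : Plane → ℝ :=
  fun x => fderiv ℝ φ x (EuclideanSpace.single i 1)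

/-- `φ ∈ C_c^∞(Ω)`. -/
def IsTest (Ω : Set Plane) (φ : Plane → ℝ) : Prop :=
  ContDiff ℝ ∞ φ ∧ HasCompactSupport φ ∧ tsupport φ ⊆ Ω

/-- The scalar space `L²(Ω)`. -/
def MemL2 (Ω : Set Plane) (v : Plane → ℝ) : Prop :=
  MemLp v 2 (volume.restrict Ω)

/-- The space `L²₀(Ω)` of square integrable functions with zero mean. -/
def MemL2Zero (Ω : Set Plane) (q : Plane → ℝ) : Prop :=
  MemL2 Ω q ∧ ∫ x in Ω, q x = 0

/-- `g` is the `i`-th weak partial derivative of `v` on `Ω`. -/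
def HasWeakPD (Ω : Set Plane) (i : Fin 2) (v g : Plane → ℝ) : Prop :=
  ∀ φ : Plane → ℝ, IsTest Ω φ → ∫ x in Ω, v x * pd i φ x = - ∫ x in Ω, g x * φ x

/-- The scalar Sobolev space `H¹(Ω)`. -/
def MemH1 (Ω : Set Plane) (v : Plane → ℝ) : Prop :=
  MemL2 Ω v ∧ ∀ i : Fin 2, ∃ g : Plane → ℝ, MemL2 Ω g ∧ HasWeakPD Ω i v g

open Classical in
/-- The `i`-th weak partial derivative in `L²(Ω)` (unique almost everywhere in `Ω`; the value `0`
is used when there is none). -/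
def weakPD (Ω : Set Plane) (i : Fin 2) (v : Plane → ℝ) : Plane → ℝ :=
  if H : ∃ g : Plane → ℝ, MemL2 Ω g ∧ HasWeakPD Ω i v g then H.choose else 0

/-- The space `H¹₀(Ω)`: the closure of `C_c^∞(Ω)` in `H¹(Ω)`. -/
def MemH10 (Ω : Set Plane) (v : Plane → ℝ) : Prop :=
  MemH1 Ω v ∧ ∃ φ : ℕ → Plane → ℝ, (∀ m, IsTest Ω (φ m)) ∧
    Tendsto (fun m => eLpNorm (fun x => φ m x - v x) 2 (volume.restrict Ω)) atTop (𝓝 0) ∧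
    ∀ i : Fin 2,
      Tendsto (fun m => eLpNorm (fun x => pd i (φ m) x - weakPD Ω i v x) 2 (volume.restrict Ω))
        atTop (𝓝 0)

/-- The divergence of a vector field with components in `H¹(Ω)`. -/
def weakDiv (Ω : Set Plane) (w : Plane → Plane) (x : Plane) : ℝ :=
  ∑ i : Fin 2, weakPD Ω i (fun y => w y i) x

/-- The space `V` of solenoidal vector fields in `H¹₀(Ω)²`. -/
def MemV (Ω : Set Plane) (w : Plane → Plane) : Prop :=
  (∀ j : Fin 2, MemH10 Ω (fun x => w x j)) ∧ ∀ᵐ x ∂(volume.restrict Ω), weakDiv Ω w x = 0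

/-- `‖w‖²`, the square of the norm of `L²(Ω)²`. -/
def l2Sq (Ω : Set Plane) (w : Plane → Plane) : ℝ :=
  ∫ x in Ω, ‖w x‖ ^ 2

/-- `|w|²`, the square of the seminorm of `H¹(Ω)²`. -/
def gradSq (Ω : Set Plane) (w : Plane → Plane) : ℝ :=
  ∑ j : Fin 2, ∑ i : Fin 2, ∫ x in Ω, (weakPD Ω i (fun y => w y j) x) ^ 2

/-- `‖w‖²_α = ‖w‖² + α |w|²`. -/
def alphaSq (Ω : Set Plane) (α : ℝ) (w : Plane → Plane) : ℝ :=
  l2Sq Ω w + α * gradSq Ω w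

/-- The field `(a · ∇) b`. -/
def advect (Ω : Set Plane) (a b : Plane → Plane) (j : Fin 2) (x : Plane) : ℝ :=
  ∑ i : Fin 2, a x i * weakPD Ω i (fun y => b y j) x

/-- The field `z × w = (-z w₂, z w₁)` for a scalar `z` (a multiple of the third axis) and a plane
field `w`. -/
def crossZ (z : Plane → ℝ) (w : Plane → Plane) (j : Fin 2) (x : Plane) : ℝ :=
  if j = 0 then - (z x * w x 1) else z x * w x 0

/-- The distribution on `Ω` given by a function. -/
def fnDist (Ω : Set Plane) (g : Plane → ℝ) (φ : Plane → ℝ) : ℝ :=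
  ∫ x in Ω, g x * φ x

/-- The distribution `Δ v` on `Ω`, for `v ∈ H¹(Ω)`. -/
def lapDist (Ω : Set Plane) (v : Plane → ℝ) (φ : Plane → ℝ) : ℝ :=
  - ∑ i : Fin 2, ∫ x in Ω, weakPD Ω i v x * pd i φ x

/-- The `j`-th component of the distribution `∇ q` on `Ω`. -/
def gradDist (Ω : Set Plane) (q : Plane → ℝ) (j : Fin 2) (φ : Plane → ℝ) : ℝ :=
  - ∫ x in Ω, q x * pd j φ x

/-- The distribution `curl F = ∂₁ F₂ - ∂₂ F₁`, for a vector distribution `F`. -/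
def curlDist (F : Fin 2 → (Plane → ℝ) → ℝ) (φ : Plane → ℝ) : ℝ :=
  F 0 (pd 1 φ) - F 1 (pd 0 φ)

/-- The distribution `w · ∇ z = div (z w)` on `Ω`, for `z ∈ L²(Ω)` and `w ∈ V`. -/
def transportDist (Ω : Set Plane) (w : Plane → Plane) (z : Plane → ℝ) (φ : Plane → ℝ) : ℝ :=
  - ∑ i : Fin 2, ∫ x in Ω, z x * w x i * pd i φ x

/-- `f ∈ L²(0, T; H(curl; Ω))`, where `f (t, x)` is the value at time `t` and place `x`. -/
def MemL2Hcurl (Ω : Set Plane) (T : ℝ) (f : ℝ × Plane → Plane) : Prop :=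
  MemLp f 2 (volume.restrict (Set.Ioo 0 T ×ˢ Ω)) ∧
  ∃ g : ℝ × Plane → ℝ, MemLp g 2 (volume.restrict (Set.Ioo 0 T ×ˢ Ω)) ∧
    ∀ᵐ t ∂(volume.restrict (Set.Ioo 0 T)), ∀ φ : Plane → ℝ, IsTest Ω φ →
      curlDist (fun j => fnDist Ω (fun x => f (t, x) j)) φ = fnDist Ω (fun x => g (t, x)) φ

/-- The average of `f` over the `n`-th time interval `(t^{n-1}, t^n)`, with `t^n = n k`. -/
def timeAvg (f : ℝ × Plane → Plane) (k : ℝ) (n : ℕ) (x : Plane) : Plane :=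
  (1 / k) • ∫ s in (((n : ℝ) - 1) * k)..((n : ℝ) * k), f (s, x)

/-- The velocities `u n`, magnetic fields `h n`, vorticities `z n`, pressures `p n` and
potentials `r n`, `0 ≤ n ≤ N`, solve the scheme that is semi-discrete in time, with step
`k = T / N`. The equations hold in the sense of distributions on `Ω`. The values `p 0`, `r 0` and
those with index above `N` play no role. -/
structure IsScheme (Ω : Set Plane) (α ν T : ℝ) (N : ℕ) (f : ℝ × Plane → Plane)
    (u₀ h₀ : Plane → Plane) (u h : ℕ → Plane → Plane) (z p r : ℕ → Plane → ℝ) : Prop where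
  u_zero : u 0 = u₀
  h_zero : h 0 = h₀
  z_zero_mem : MemL2 Ω (z 0)
  /-- `z⁰ = curl (u₀ - α Δ u₀)` -/
  z_zero : ∀ φ : Plane → ℝ, IsTest Ω φ →
    fnDist Ω (z 0) φ =
      curlDist (fun j ψ => fnDist Ω (fun x => u₀ x j) ψ
        - α * lapDist Ω (fun x => u₀ x j) ψ) φ
  u_mem : ∀ n < N, MemV Ω (u (n + 1))
  h_mem : ∀ n < N, MemV Ω (h (n + 1))
  z_mem : ∀ n < N, MemL2 Ω (z (n + 1))
  p_mem : ∀ n < N, MemL2Zero Ω (p (n + 1))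
  r_mem : ∀ n < N, MemL2Zero Ω (r (n + 1))
  /-- the equation of the velocity -/
  eq_u : ∀ n < N, ∀ j : Fin 2, ∀ φ : Plane → ℝ, IsTest Ω φ →
    1 / (T / N) * fnDist Ω (fun x => u (n + 1) x j - u n x j) φ
      - α * (1 / (T / N)) * lapDist Ω (fun x => u (n + 1) x j - u n x j) φ
      - ν * lapDist Ω (fun x => u (n + 1) x j) φ
      + fnDist Ω (crossZ (z n) (u (n + 1)) j) φ
    = fnDist Ω (fun x => timeAvg f (T / N) (n + 1) x j) φ
      + fnDist Ω (advect Ω (h (n + 1)) (h (n + 1)) j) φ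
      - gradDist Ω (fun x => p (n + 1) x + ‖h (n + 1) x‖ ^ 2) j φ
  /-- the equation of the magnetic field -/
  eq_h : ∀ n < N, ∀ j : Fin 2, ∀ φ : Plane → ℝ, IsTest Ω φ →
    1 / (T / N) * fnDist Ω (fun x => h (n + 1) x j - h n x j) φ
      - lapDist Ω (fun x => h (n + 1) x j) φ
      + fnDist Ω (advect Ω (u (n + 1)) (h (n + 1)) j) φ
      - fnDist Ω (advect Ω (h (n + 1)) (u (n + 1)) j) φ
    = - gradDist Ω (r (n + 1)) j φ
  /-- the transport equation of the vorticity -/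
  eq_z : ∀ n < N, ∀ φ : Plane → ℝ, IsTest Ω φ →
    α / (T / N) * fnDist Ω (fun x => z (n + 1) x - z n x) φ
      + ν * fnDist Ω (z (n + 1)) φ
      + α * transportDist Ω (u (n + 1)) (z (n + 1)) φ
    = ν * curlDist (fun j => fnDist Ω (fun x => u (n + 1) x j)) φ
      + α * curlDist (fun j => fnDist Ω (fun x => timeAvg f (T / N) (n + 1) x j)) φ
      + α * curlDist (fun j => fnDist Ω (advect Ω (h (n + 1)) (h (n + 1)) j)) φ
      - α * curlDist (gradDist Ω (fun x => p (n + 1) x + ‖h (n + 1) x‖ ^ 2)) φ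

end GradeTwoMHD

end

/-!
The estimate is the energy balance of the scheme. Write `u, h` for the old and `U, H` for the new
fields of a time interval of length `k`. Testing the equation of the velocity with `U` and that of
the magnetic field with `H` makes `z × U` and the pressures vanish, the former pointwise and the
latter because `U` and `H` are solenoidal; `(U · ∇) H` does no work on `H`, and the work of
`(H · ∇) U` on `H` cancels that of `(H · ∇) H` on `U`, because the form `∫ (a · ∇v) w` is
skew-symmetric in `v, w` for solenoidal `a` (`integral_advect_add_symm`). The identity
`2 (a - b) a = a² - b² + (a - b)²` turns the difference quotients into differences of energies. The
force is absorbed by `ν ‖∇U‖²` through Young's and Poincaré's inequalities, which leaves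
`C² k / (2 ν) ‖F‖²` for the time average `F` of `f`, and `k ‖F‖²` is at most the squared norm of `f`
over the interval (`timeAvg_bound`). Summing over the intervals bounds the sum of the left-hand
sides of both claims. The transport equation of the vorticity plays no part: only
`z ∈ L²(Ω)` matters.

The equations hold against `C_c^∞` functions only, whereas `U` and `H` are in `H¹₀(Ω)²`. The products
`z U` and `(H · ∇) H` are in `L^{4/3}(Ω)`, since `H¹₀(Ω) ⊆ L⁴(Ω)` in the plane, and the
Gagliardo–Nirenberg–Sobolev inequality shows that approximation in `H¹₀(Ω)` implies approximation in
`L⁴(Ω)`; hence every term of the equations is continuous in the test function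
(`MemH10.exists_approx`).
-/

namespace GradeTwoMHD

open scoped NNReal

variable {Ω : Set Plane}

/-! ### Hölder exponents -/

instance holderTriple_two_four : ENNReal.HolderTriple 2 4 ((4 / 3 : ℝ≥0) : ℝ≥0∞) where
  inv_add_inv_eq_inv := by
    rw [← ENNReal.coe_inv (by norm_num)]
    rw [show (2 : ℝ≥0∞) = ((2 : ℝ≥0) : ℝ≥0∞) by rfl, show (4 : ℝ≥0∞) = ((4 : ℝ≥0) : ℝ≥0∞) by rfl,
      ← ENNReal.coe_inv (by norm_num), ← ENNReal.coe_inv (by norm_num), ← ENNReal.coe_add]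
    congr 1
    ext
    push_cast
    norm_num

instance holderTriple_fourThirds_four : ENNReal.HolderTriple ((4 / 3 : ℝ≥0) : ℝ≥0∞) 4 1 where
  inv_add_inv_eq_inv := by
    rw [← ENNReal.coe_inv (by norm_num)]
    rw [show (4 : ℝ≥0∞) = ((4 : ℝ≥0) : ℝ≥0∞) by rfl, ← ENNReal.coe_inv (by norm_num),
      ← ENNReal.coe_add, inv_one, ← ENNReal.coe_one]
    congr 1
    ext
    push_cast
    norm_num

instance holderTriple_four_four : ENNReal.HolderTriple 4 4 2 where
  inv_add_inv_eq_inv := by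
    rw [show (2 : ℝ≥0∞) = ((2 : ℝ≥0) : ℝ≥0∞) by rfl, show (4 : ℝ≥0∞) = ((4 : ℝ≥0) : ℝ≥0∞) by rfl,
      ← ENNReal.coe_inv (by norm_num), ← ENNReal.coe_inv (by norm_num), ← ENNReal.coe_add]
    congr 1
    ext
    push_cast
    norm_num

theorem integrable_mul {p q : ℝ≥0∞} [ENNReal.HolderTriple p q 1] {μ : Measure Plane}
    {a b : Plane → ℝ} (ha : MemLp a p μ) (hb : MemLp b q μ) :
    Integrable (fun x => a x * b x) μ :=
  memLp_one_iff_integrable.1 (hb.mul' ha)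

/-- Hölder continuity: for `1/p + 1/q = 1` and `g ∈ L^p`, convergence of `w m` in `L^q` passes to
the integrals against `g`. -/
theorem tendsto_integral_mul {p q : ℝ≥0∞} [ENNReal.HolderTriple p q 1] {μ : Measure Plane}
    {g v : Plane → ℝ} {w : ℕ → Plane → ℝ} (hg : MemLp g p μ) (hv : MemLp v q μ)
    (hw : ∀ m, MemLp (w m) q μ)
    (hlim : Tendsto (fun m => eLpNorm (fun x => w m x - v x) q μ) atTop (𝓝 0)) :
    Tendsto (fun m => ∫ x, g x * w m x ∂μ) atTop (𝓝 (∫ x, g x * v x ∂μ)) := by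
  have hup : Tendsto (fun m => eLpNorm g p μ * eLpNorm (fun x => w m x - v x) q μ) atTop
      (𝓝 (eLpNorm g p μ * 0)) := ENNReal.Tendsto.const_mul hlim (Or.inr hg.2.ne)
  rw [mul_zero] at hup
  refine tendsto_integral_of_L1' _ (integrable_mul hg hv).1
    (.of_forall fun m => integrable_mul hg (hw m)) ?_
  refine tendsto_of_tendsto_of_tendsto_of_le_of_le tendsto_const_nhds hup (fun _ => zero_le) ?_
  intro m
  have hle := eLpNorm_smul_le_mul_eLpNorm (r := 1) (p := p) (q := q) ((hw m).sub hv).1 hg.1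
  have he : ((fun x => g x * w m x) - fun x => g x * v x) = g • (w m - v) := by
    ext x
    simp only [Pi.sub_apply, Pi.smul_apply', smul_eq_mul, mul_sub]
  change eLpNorm ((fun x => g x * w m x) - fun x => g x * v x) 1 μ ≤ _
  rw [he]
  exact hle

/-! ### Test functions -/

theorem IsTest.contDiff_pd {φ : Plane → ℝ} (h : IsTest Ω φ) (i : Fin 2) :
    ContDiff ℝ ∞ (pd i φ) :=
  ((h.1.fderiv_right (m := ∞) (by simp)).clm_apply contDiff_const)

theorem IsTest.memLp {φ : Plane → ℝ} (h : IsTest Ω φ) (q : ℝ≥0∞) :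
    MemLp φ q (volume.restrict Ω) :=
  (h.1.continuous.memLp_of_hasCompactSupport h.2.1).restrict _

theorem IsTest.pd {φ : Plane → ℝ} (h : IsTest Ω φ) (i : Fin 2) : IsTest Ω (pd i φ) := by
  have hsub : tsupport (GradeTwoMHD.pd i φ) ⊆ tsupport φ := by
    refine closure_minimal ?_ (isClosed_tsupport φ)
    intro x hx
    refine support_fderiv_subset ℝ (Function.mem_support.2 ?_)
    intro h0
    exact hx (by simp [GradeTwoMHD.pd, h0])
  exact ⟨h.contDiff_pd i, h.2.1.mono' (subset_closure.trans hsub), hsub.trans h.2.2⟩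

theorem IsTest.sub {φ ψ : Plane → ℝ} (h : IsTest Ω φ) (h' : IsTest Ω ψ) :
    IsTest Ω (fun x => φ x - ψ x) :=
  ⟨h.1.sub h'.1, h.2.1.sub h'.2.1, (tsupport_sub φ ψ).trans (Set.union_subset h.2.2 h'.2.2)⟩

theorem IsTest.mul {φ ψ : Plane → ℝ} (h : IsTest Ω φ) (h' : IsTest Ω ψ) :
    IsTest Ω (fun x => φ x * ψ x) :=
  ⟨h.1.mul h'.1, h.2.1.mul_right, (tsupport_mul_subset_left).trans h.2.2⟩

theorem pd_sub {φ ψ : Plane → ℝ} (h : IsTest Ω φ) (h' : IsTest Ω ψ) (i : Fin 2) (x : Plane) :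
    pd i (fun x => φ x - ψ x) x = pd i φ x - pd i ψ x := by
  unfold pd
  rw [fderiv_fun_sub ((h.1.differentiable (by simp)) x) ((h'.1.differentiable (by simp)) x)]
  rfl

theorem pd_mul {φ ψ : Plane → ℝ} (h : IsTest Ω φ) (h' : IsTest Ω ψ) (i : Fin 2) (x : Plane) :
    pd i (fun x => φ x * ψ x) x = φ x * pd i ψ x + ψ x * pd i φ x := by
  unfold pd
  rw [fderiv_fun_mul ((h.1.differentiable (by simp)) x) ((h'.1.differentiable (by simp)) x)]
  rfl

/-! ### The Sobolev inequality for test functions -/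

theorem norm_fderiv_le_sum_pd (φ : Plane → ℝ) (x : Plane) :
    ‖fderiv ℝ φ x‖ ≤ ∑ i : Fin 2, ‖pd i φ x‖ := by
  refine ContinuousLinearMap.opNorm_le_bound _ (Finset.sum_nonneg fun _ _ => norm_nonneg _) ?_
  intro y
  have hy : y = ∑ i : Fin 2, y i • EuclideanSpace.single i (1 : ℝ) := by
    ext j
    fin_cases j <;> simp
  calc ‖fderiv ℝ φ x y‖ = ‖∑ i : Fin 2, y i • pd i φ x‖ := by
        conv_lhs => rw [hy, map_sum]
        simp only [map_smul, pd]
    _ ≤ ∑ i : Fin 2, ‖y i • pd i φ x‖ := norm_sum_le _ _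
    _ ≤ ∑ i : Fin 2, ‖pd i φ x‖ * ‖y‖ := by
        refine Finset.sum_le_sum fun i _ => ?_
        rw [norm_smul, mul_comm]
        gcongr
        exact PiLp.norm_apply_le y i
    _ = _ := by rw [Finset.sum_mul]

/-- The Gagliardo–Nirenberg–Sobolev inequality in the plane, from the exponent `4/3` of the gradient
(which the exponent `2` controls, as `Ω` is bounded) to the exponent `4` of the function. The
constant depends only on `Ω`. -/
theorem exists_eLpNorm_four_le_of_isTest (hbd : Bornology.IsBounded Ω) :
    ∃ C : ℝ≥0, ∀ φ : Plane → ℝ, IsTest Ω φ →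
      eLpNorm φ 4 (volume.restrict Ω)
        ≤ C * ∑ i : Fin 2, eLpNorm (pd i φ) 2 (volume.restrict Ω) := by
  let K := eLpNormLESNormFDerivOfLeConst ℝ (volume : Measure Plane) Ω (4 / 3) 4
  let M : ℝ≥0∞ := (volume.restrict Ω) Set.univ ^
    (1 / ((4 / 3 : ℝ≥0) : ℝ≥0∞).toReal - 1 / (2 : ℝ≥0∞).toReal)
  have hM : M ≠ ⊤ := by
    refine ENNReal.rpow_ne_top_of_nonneg ?_ ?_
    · norm_num
    · rw [Measure.restrict_apply_univ]
      exact hbd.measure_lt_top.ne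
  refine ⟨K * M.toNNReal, fun φ hφ => ?_⟩
  have hsupp : Function.support (fun x => ‖fderiv ℝ φ x‖) ⊆ Ω := by
    intro x hx
    refine hφ.2.2 (support_fderiv_subset ℝ (Function.mem_support.2 fun h0 => hx ?_))
    simp only [h0, norm_zero]
  have hc : Continuous (fderiv ℝ φ) := (hφ.1.continuous_fderiv (by simp))
  have h1 : eLpNorm φ 4 volume ≤ K * eLpNorm (fderiv ℝ φ) ((4 / 3 : ℝ≥0) : ℝ≥0∞) volume := by
    refine eLpNorm_le_eLpNorm_fderiv_of_le (p := 4 / 3) (q := 4) volume (hφ.1.of_le (by simp))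
      (subset_closure.trans hφ.2.2) ?_ ?_ ?_ hbd
    · rw [← NNReal.coe_le_coe]; push_cast; norm_num
    · rw [← NNReal.coe_lt_coe]; push_cast; norm_num
    · push_cast; norm_num
  have h2 : eLpNorm (fderiv ℝ φ) ((4 / 3 : ℝ≥0) : ℝ≥0∞) volume
      ≤ eLpNorm (fderiv ℝ φ) 2 (volume.restrict Ω) * M := by
    rw [← eLpNorm_norm (fderiv ℝ φ), ← eLpNorm_norm (fderiv ℝ φ),
      ← eLpNorm_restrict_eq_of_support_subset hsupp]
    refine eLpNorm_le_eLpNorm_mul_rpow_measure_univ ?_ hc.norm.aestronglyMeasurable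
    rw [show (2 : ℝ≥0∞) = ((2 : ℝ≥0) : ℝ≥0∞) by rfl, ENNReal.coe_le_coe, ← NNReal.coe_le_coe]
    push_cast
    norm_num
  have h3 : eLpNorm (fderiv ℝ φ) 2 (volume.restrict Ω)
      ≤ ∑ i : Fin 2, eLpNorm (pd i φ) 2 (volume.restrict Ω) := by
    calc eLpNorm (fderiv ℝ φ) 2 (volume.restrict Ω)
        ≤ eLpNorm (∑ i : Fin 2, fun x => ‖pd i φ x‖) 2 (volume.restrict Ω) := by
          refine eLpNorm_mono_real fun x => ?_
          simpa using norm_fderiv_le_sum_pd φ x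
      _ ≤ ∑ i : Fin 2, eLpNorm (fun x => ‖pd i φ x‖) 2 (volume.restrict Ω) :=
          eLpNorm_sum_le (fun i _ =>
            (hφ.contDiff_pd i).continuous.norm.aestronglyMeasurable) (by norm_num)
      _ = _ := by simp only [eLpNorm_norm]
  calc eLpNorm φ 4 (volume.restrict Ω) ≤ eLpNorm φ 4 volume :=
        eLpNorm_mono_measure _ Measure.restrict_le_self
    _ ≤ K * (eLpNorm (fderiv ℝ φ) 2 (volume.restrict Ω) * M) := h1.trans (by gcongr)
    _ ≤ K * ((∑ i : Fin 2, eLpNorm (pd i φ) 2 (volume.restrict Ω)) * M) := by gcongr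
    _ = _ := by
      rw [ENNReal.coe_mul, ENNReal.coe_toNNReal hM]
      ring

/-- The inequality for test functions passes to `L²`-limits, by Fatou's lemma along a subsequence
that converges almost everywhere. The limits `g i` of the derivatives are kept arbitrary, so that
the lemma applies both to a sequence `φ m` and to the differences `φ m - φ l` as `l → ∞`. -/
theorem eLpNorm_four_le_of_tendsto (C : ℝ≥0)
    (hC : ∀ φ : Plane → ℝ, IsTest Ω φ → eLpNorm φ 4 (volume.restrict Ω)
        ≤ C * ∑ i : Fin 2, eLpNorm (pd i φ) 2 (volume.restrict Ω))
    {φ : ℕ → Plane → ℝ} {v : Plane → ℝ} {g : Fin 2 → Plane → ℝ} (hφ : ∀ m, IsTest Ω (φ m))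
    (hv : AEStronglyMeasurable v (volume.restrict Ω))
    (hg : ∀ i, AEStronglyMeasurable (g i) (volume.restrict Ω))
    (h0 : Tendsto (fun m => eLpNorm (fun x => φ m x - v x) 2 (volume.restrict Ω)) atTop (𝓝 0))
    (h1 : ∀ i, Tendsto (fun m => eLpNorm (fun x => pd i (φ m) x - g i x) 2 (volume.restrict Ω))
        atTop (𝓝 0)) :
    eLpNorm v 4 (volume.restrict Ω)
      ≤ C * ∑ i : Fin 2, eLpNorm (g i) 2 (volume.restrict Ω) := by
  obtain ⟨ns, hns, hae⟩ := (tendstoInMeasure_of_tendsto_eLpNorm (p := 2) (by norm_num)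
    (fun m => ((hφ m).memLp 2).1) hv h0).exists_seq_tendsto_ae
  have hfatou := Lp.eLpNorm_lim_le_liminf_eLpNorm (p := 4)
    (fun m => ((hφ (ns m)).memLp 2).1) v hae
  have hup : Tendsto (fun m => (C : ℝ≥0∞) * ∑ i : Fin 2,
      (eLpNorm (fun x => pd i (φ (ns m)) x - g i x) 2 (volume.restrict Ω)
        + eLpNorm (g i) 2 (volume.restrict Ω))) atTop
      (𝓝 (C * ∑ i : Fin 2, (0 + eLpNorm (g i) 2 (volume.restrict Ω)))) := by
    refine ENNReal.Tendsto.const_mul (tendsto_finsetSum _ fun i _ => ?_)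
      (Or.inr ENNReal.coe_ne_top)
    exact ((h1 i).comp hns.tendsto_atTop).add tendsto_const_nhds
  simp only [zero_add] at hup
  rw [← hup.liminf_eq]
  refine hfatou.trans (liminf_le_liminf (.of_forall fun m => ?_))
  refine (hC _ (hφ _)).trans ?_
  gcongr with i
  have := eLpNorm_add_le (p := 2) (f := fun x => pd i (φ (ns m)) x - g i x) (g := g i)
    ((((hφ (ns m)).pd i).memLp 2).1.sub (hg i)) (hg i) (by norm_num)
  refine le_trans (le_of_eq ?_) this
  congr 1
  ext x
  simp

/-! ### Weak derivatives -/

theorem MemH1.memLp_weakPD {v : Plane → ℝ} (h : MemH1 Ω v) (i : Fin 2) :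
    MemLp (weakPD Ω i v) 2 (volume.restrict Ω) := by
  unfold weakPD
  rw [dif_pos (h.2 i)]
  exact (h.2 i).choose_spec.1

theorem MemH1.hasWeakPD {v : Plane → ℝ} (h : MemH1 Ω v) (i : Fin 2) :
    HasWeakPD Ω i v (weakPD Ω i v) := by
  unfold weakPD
  rw [dif_pos (h.2 i)]
  exact (h.2 i).choose_spec.2

/-- Weak derivatives are unique almost everywhere. This is what makes `weakPD`, a choice among the
weak derivatives, additive up to null sets. -/
theorem HasWeakPD.ae_eq (hΩ : IsOpen Ω) {i : Fin 2} {v g g' : Plane → ℝ} (hg : MemL2 Ω g)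
    (hg' : MemL2 Ω g') (h : HasWeakPD Ω i v g) (h' : HasWeakPD Ω i v g') :
    g =ᵐ[volume.restrict Ω] g' := by
  have hloc : LocallyIntegrableOn (fun x => g x - g' x) Ω volume :=
    locallyIntegrableOn_of_locallyIntegrable_restrict
      ((hg.sub hg').locallyIntegrable (by norm_num))
  have := hΩ.ae_eq_zero_of_integral_contDiff_smul_eq_zero (μ := volume) hloc ?_
  · rw [Filter.EventuallyEq, ae_restrict_iff' hΩ.measurableSet]
    filter_upwards [this] with x hx hxΩ
    exact sub_eq_zero.1 (hx hxΩ)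
  · intro φ h1 h2 h3
    have hφ : IsTest Ω φ := ⟨h1, h2, h3⟩
    have e : ∫ x in Ω, g x * φ x = ∫ x in Ω, g' x * φ x :=
      neg_injective ((h φ hφ).symm.trans (h' φ hφ))
    rw [← setIntegral_eq_integral_of_forall_compl_eq_zero (s := Ω)]
    · calc ∫ x in Ω, φ x • (g x - g' x) = ∫ x in Ω, (g x * φ x - g' x * φ x) := by
            congr 1; ext x; simp; ring
        _ = 0 := by
            rw [integral_sub (integrable_mul hg (hφ.memLp 2))
              (integrable_mul hg' (hφ.memLp 2)), e, sub_self]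
    · intro x hx
      rw [image_eq_zero_of_notMem_tsupport (fun hx' => hx (h3 hx')), zero_smul]

theorem weakPD_sub_ae (hΩ : IsOpen Ω) {v w : Plane → ℝ} (hv : MemH1 Ω v) (hw : MemH1 Ω w)
    (i : Fin 2) : MemH1 Ω (fun x => v x - w x) ∧ weakPD Ω i (fun x => v x - w x)
      =ᵐ[volume.restrict Ω] fun x => weakPD Ω i v x - weakPD Ω i w x := by
  have key : ∀ j, HasWeakPD Ω j (fun x => v x - w x)
      (fun x => weakPD Ω j v x - weakPD Ω j w x) := by
    intro j φ hφ
    simp only [sub_mul]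
    rw [integral_sub (integrable_mul hv.1 ((hφ.pd j).memLp 2))
        (integrable_mul hw.1 ((hφ.pd j).memLp 2)),
      integral_sub (integrable_mul (hv.memLp_weakPD j) (hφ.memLp 2))
        (integrable_mul (hw.memLp_weakPD j) (hφ.memLp 2)),
      hv.hasWeakPD j φ hφ, hw.hasWeakPD j φ hφ]
    ring
  have hmem : MemH1 Ω (fun x => v x - w x) :=
    ⟨hv.1.sub hw.1, fun j => ⟨_, (hv.memLp_weakPD j).sub (hw.memLp_weakPD j), key j⟩⟩
  exact ⟨hmem, HasWeakPD.ae_eq hΩ (hmem.memLp_weakPD i)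
    ((hv.memLp_weakPD i).sub (hw.memLp_weakPD i)) (hmem.hasWeakPD i) (key i)⟩

/-! ### The space `H¹₀(Ω)`: embedding into `L⁴`, approximation, Poincaré's inequality -/

theorem exists_eLpNorm_four_le (hbd : Bornology.IsBounded Ω) :
    ∃ C : ℝ≥0, ∀ v : Plane → ℝ, MemH10 Ω v →
      eLpNorm v 4 (volume.restrict Ω)
        ≤ C * ∑ i : Fin 2, eLpNorm (weakPD Ω i v) 2 (volume.restrict Ω) := by
  obtain ⟨C, hC⟩ := exists_eLpNorm_four_le_of_isTest hbd
  refine ⟨C, fun v hv => ?_⟩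
  obtain ⟨hv1, φ, hφ, h0, h1⟩ := hv
  exact eLpNorm_four_le_of_tendsto C hC hφ hv1.1.1 (fun i => (hv1.memLp_weakPD i).1) h0 h1

theorem MemH10.memLp_four (hbd : Bornology.IsBounded Ω) {v : Plane → ℝ}
    (hv : MemH10 Ω v) : MemLp v 4 (volume.restrict Ω) := by
  obtain ⟨C, hC⟩ := exists_eLpNorm_four_le hbd
  refine ⟨hv.1.1.1, (hC v hv).trans_lt ?_⟩
  exact ENNReal.mul_lt_top ENNReal.coe_lt_top
    (ENNReal.sum_lt_top.2 fun i _ => (hv.1.memLp_weakPD i).2)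

/-- A function of `H¹₀(Ω)` has approximating test functions that may be used against every
`g ∈ L^{4/3}(Ω)`, and whose derivatives may be used against every `g ∈ L²(Ω)`. The exponent `4/3`
is that of a product of `L²` and `L⁴` functions, such as `z × u` and `(h · ∇) h`. -/
theorem MemH10.exists_approx (hbd : Bornology.IsBounded Ω) {v : Plane → ℝ}
    (hv : MemH10 Ω v) : ∃ φ : ℕ → Plane → ℝ, (∀ m, IsTest Ω (φ m)) ∧
      (∀ g : Plane → ℝ, MemLp g ((4 / 3 : ℝ≥0) : ℝ≥0∞) (volume.restrict Ω) →
        Tendsto (fun m => ∫ x in Ω, g x * φ m x) atTop (𝓝 (∫ x in Ω, g x * v x))) ∧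
      ∀ (i : Fin 2) (g : Plane → ℝ), MemL2 Ω g →
        Tendsto (fun m => ∫ x in Ω, g x * pd i (φ m) x) atTop
          (𝓝 (∫ x in Ω, g x * weakPD Ω i v x)) := by
  have hv4 := hv.memLp_four hbd
  obtain ⟨C, hC⟩ := exists_eLpNorm_four_le_of_isTest hbd
  obtain ⟨hv1, φ, hφ, h0, h1⟩ := hv
  -- The bound for `φ m - v` comes from that for `φ m - φ l` as `l → ∞`.
  have hswap : ∀ (a b : Plane → ℝ),
      eLpNorm (fun x => a x - b x) 2 (volume.restrict Ω)
        = eLpNorm (fun x => b x - a x) 2 (volume.restrict Ω) := fun a b =>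
    eLpNorm_sub_comm a b 2 _
  have hbound : ∀ m, eLpNorm (fun x => φ m x - v x) 4 (volume.restrict Ω)
      ≤ C * ∑ i : Fin 2,
        eLpNorm (fun x => pd i (φ m) x - weakPD Ω i v x) 2 (volume.restrict Ω) := by
    intro m
    refine eLpNorm_four_le_of_tendsto C hC (φ := fun l x => φ m x - φ l x)
      (g := fun i x => pd i (φ m) x - weakPD Ω i v x) (fun l => (hφ m).sub (hφ l))
      (((hφ m).memLp 2).sub hv1.1).1
      (fun i => ((((hφ m).pd i).memLp 2).sub (hv1.memLp_weakPD i)).1) ?_ fun i => ?_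
    · refine h0.congr fun l => ?_
      rw [hswap]
      congr 1; ext x; ring
    · refine (h1 i).congr fun l => ?_
      rw [hswap]
      congr 1; ext x
      rw [pd_sub (hφ m) (hφ l)]; ring
  have h4 : Tendsto (fun m => eLpNorm (fun x => φ m x - v x) 4 (volume.restrict Ω))
      atTop (𝓝 0) := by
    refine tendsto_of_tendsto_of_tendsto_of_le_of_le tendsto_const_nhds ?_
      (fun _ => zero_le) hbound
    simpa using! ENNReal.Tendsto.const_mul (tendsto_finsetSum Finset.univ fun i _ => h1 i)
      (Or.inr (ENNReal.coe_ne_top (r := C)))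
  refine ⟨φ, hφ, fun g hg => ?_, fun i g hg => ?_⟩
  · exact tendsto_integral_mul hg hv4 (fun m => (hφ m).memLp 4) h4
  · exact tendsto_integral_mul hg (hv1.memLp_weakPD i) (fun m => ((hφ m).pd i).memLp 2) (h1 i)

theorem isFiniteMeasure_restrict (hbd : Bornology.IsBounded Ω) :
    IsFiniteMeasure (volume.restrict Ω) :=
  ⟨by rw [Measure.restrict_apply_univ]; exact hbd.measure_lt_top⟩

theorem toReal_eLpNorm_two_sq {μ : Measure Plane} {v : Plane → ℝ} (hv : MemLp v 2 μ) :
    (eLpNorm v 2 μ).toReal ^ 2 = ∫ x, v x ^ 2 ∂μ := by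
  have h0 : 0 ≤ ∫ x, v x ^ 2 ∂μ := integral_nonneg fun _ => sq_nonneg _
  rw [hv.eLpNorm_eq_integral_rpow_norm (by norm_num) (by norm_num)]
  simp only [ENNReal.toReal_ofNat, Real.rpow_ofNat, Real.norm_eq_abs, sq_abs]
  rw [ENNReal.toReal_ofReal (by positivity), ← Real.rpow_mul_natCast h0]
  norm_num

theorem l2Sq_eq_sum {w : Plane → Plane} (hw : ∀ j, MemL2 Ω (fun x => w x j)) :
    l2Sq Ω w = ∑ j : Fin 2, ∫ x in Ω, w x j ^ 2 := by
  unfold l2Sq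
  rw [← integral_finsetSum _ fun j _ => (hw j).integrable_sq]
  congr 1
  ext x
  rw [EuclideanSpace.norm_sq_eq]
  simp

/-- The Poincaré inequality on `H¹₀(Ω)²`. Its constant is the constant of the energy estimate. -/
theorem exists_poincare (hbd : Bornology.IsBounded Ω) :
    ∃ C : ℝ, 0 < C ∧ ∀ w : Plane → Plane, (∀ j, MemH10 Ω (fun x => w x j)) →
      l2Sq Ω w ≤ C ^ 2 * gradSq Ω w := by
  have := isFiniteMeasure_restrict hbd
  obtain ⟨K, hK⟩ := exists_eLpNorm_four_le hbd
  let M : ℝ≥0∞ := (volume.restrict Ω) Set.univ ^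
    (1 / (2 : ℝ≥0∞).toReal - 1 / (4 : ℝ≥0∞).toReal)
  have hM : M ≠ ⊤ := ENNReal.rpow_ne_top_of_nonneg (by norm_num) (measure_ne_top _ _)
  have hscalar : ∀ v, MemH10 Ω v → ∫ x in Ω, v x ^ 2
      ≤ 2 * (K * M.toReal) ^ 2 * ∑ i : Fin 2, ∫ x in Ω, weakPD Ω i v x ^ 2 := by
    intro v hv
    have hfin : ∀ i, eLpNorm (weakPD Ω i v) 2 (volume.restrict Ω) ≠ ⊤ :=
      fun i => (hv.1.memLp_weakPD i).2.ne
    have h2 : eLpNorm v 2 (volume.restrict Ω)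
        ≤ K * (∑ i : Fin 2, eLpNorm (weakPD Ω i v) 2 (volume.restrict Ω)) * M :=
      (eLpNorm_le_eLpNorm_mul_rpow_measure_univ (q := 4) (by norm_num) hv.1.1.1).trans
        (mul_le_mul_left (hK v hv) _)
    have h3 := ENNReal.toReal_mono (ENNReal.mul_ne_top (ENNReal.mul_ne_top ENNReal.coe_ne_top
      (ENNReal.sum_ne_top.2 fun i _ => hfin i)) hM) h2
    rw [ENNReal.toReal_mul, ENNReal.toReal_mul, ENNReal.toReal_sum fun i _ => hfin i,
      ENNReal.coe_toReal] at h3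
    rw [← toReal_eLpNorm_two_sq hv.1.1]
    simp only [← toReal_eLpNorm_two_sq (hv.1.memLp_weakPD _)]
    rw [Fin.sum_univ_two] at h3 ⊢
    set a := (eLpNorm (weakPD Ω 0 v) 2 (volume.restrict Ω)).toReal
    set b := (eLpNorm (weakPD Ω 1 v) 2 (volume.restrict Ω)).toReal
    calc (eLpNorm v 2 (volume.restrict Ω)).toReal ^ 2 ≤ (K * (a + b) * M.toReal) ^ 2 :=
          pow_le_pow_left₀ ENNReal.toReal_nonneg h3 2
      _ = (K * M.toReal) ^ 2 * (a + b) ^ 2 := by ring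
      _ ≤ (K * M.toReal) ^ 2 * (2 * (a ^ 2 + b ^ 2)) := by gcongr; exact add_sq_le
      _ = _ := by ring
  refine ⟨2 * (K * M.toReal) + 1, by positivity, fun w hw => ?_⟩
  rw [l2Sq_eq_sum fun j => (hw j).1.1, gradSq, Finset.mul_sum]
  refine Finset.sum_le_sum fun j _ => (hscalar _ (hw j)).trans ?_
  have h0 : 0 ≤ ∑ i : Fin 2, ∫ x in Ω, weakPD Ω i (fun y => w y j) x ^ 2 :=
    Finset.sum_nonneg fun i _ => integral_nonneg fun _ => sq_nonneg _
  have h1 : (0 : ℝ) ≤ K * M.toReal := by positivity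
  gcongr
  nlinarith

/-! ### Solenoidal fields and the trilinear form -/

/-- A pressure does no work on a solenoidal field. -/
theorem integral_mul_weakDiv {g : Plane → ℝ} {a : Plane → Plane} (hg : MemL2 Ω g)
    (ha : MemV Ω a) :
    ∑ i : Fin 2, ∫ x in Ω, g x * weakPD Ω i (fun y => a y i) x = 0 := by
  rw [← integral_finsetSum _ fun i _ => integrable_mul hg ((ha.1 i).1.memLp_weakPD i),
    ← integral_zero Plane ℝ (μ := volume.restrict Ω)]
  refine integral_congr_ae ?_
  filter_upwards [ha.2] with x hx
  rw [← Finset.mul_sum]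
  unfold weakDiv at hx
  rw [hx, mul_zero]

/-- For solenoidal `a`, the trilinear form `∫ (a · ∇v) w` is skew-symmetric in `v, w ∈ H¹₀(Ω)`:
for test functions this is `∫ a · ∇(v w) = 0`, and one argument at a time passes to the limit. -/
theorem integral_advect_add_symm (hbd : Bornology.IsBounded Ω) {a : Plane → Plane}
    (ha : MemV Ω a) {v w : Plane → ℝ} (hv : MemH10 Ω v) (hw : MemH10 Ω w) :
    ∑ i : Fin 2, ((∫ x in Ω, (a x i * weakPD Ω i v x) * w x)
      + ∫ x in Ω, (a x i * v x) * weakPD Ω i w x) = 0 := by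
  have ha4 : ∀ i, MemLp (fun x => a x i) 4 (volume.restrict Ω) := fun i => (ha.1 i).memLp_four hbd
  have htest : ∀ φ ψ, IsTest Ω φ → IsTest Ω ψ →
      ∑ i : Fin 2, ((∫ x in Ω, (a x i * φ x) * pd i ψ x)
        + ∫ x in Ω, (a x i * pd i φ x) * ψ x) = 0 := by
    intro φ ψ hφ hψ
    have h0 := integral_mul_weakDiv ((hφ.mul hψ).memLp 2) ha
    rw [← neg_eq_zero, ← h0, ← Finset.sum_neg_distrib]
    refine Finset.sum_congr rfl fun i _ => ?_
    rw [← integral_add, neg_eq_iff_eq_neg]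
    · have := (ha.1 i).1.hasWeakPD i _ (hφ.mul hψ)
      simp only [pd_mul hφ hψ] at this
      have hcomm : ∫ x in Ω, φ x * ψ x * weakPD Ω i (fun y => a y i) x
          = ∫ x in Ω, weakPD Ω i (fun y => a y i) x * (φ x * ψ x) := by
        congr 1; ext x; ring
      rw [hcomm, ← this]
      congr 1; ext x; ring
    · exact integrable_mul (p := 2) ((hφ.memLp 4).mul' (ha4 i)) ((hψ.pd i).memLp 2)
    · exact integrable_mul (p := 2) (((hφ.pd i).memLp 4).mul' (ha4 i)) (hψ.memLp 2)
  have hhalf : ∀ φ, IsTest Ω φ →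
      ∑ i : Fin 2, ((∫ x in Ω, (a x i * φ x) * weakPD Ω i v x)
        + ∫ x in Ω, (a x i * pd i φ x) * v x) = 0 := by
    intro φ hφ
    obtain ⟨ψ, hψ, h0, h1⟩ := hv.exists_approx hbd
    have hlim := tendsto_finsetSum Finset.univ fun (i : Fin 2) _ =>
      (h1 i (fun x => a x i * φ x) ((hφ.memLp 4).mul' (ha4 i))).add
        (h0 (fun x => a x i * pd i φ x) (((ha4 i).mul' ((hφ.pd i).memLp 2)).ae_eq
          (.of_forall fun x => mul_comm _ _)))
    refine tendsto_nhds_unique hlim ?_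
    simp only [htest φ _ hφ (hψ _), tendsto_const_nhds]
  obtain ⟨ψ, hψ, h0, h1⟩ := hw.exists_approx hbd
  have hlim := tendsto_finsetSum Finset.univ fun (i : Fin 2) _ =>
    (h0 (fun x => a x i * weakPD Ω i v x) (((ha4 i).mul' (hv.1.memLp_weakPD i)).ae_eq
        (.of_forall fun x => mul_comm _ _))).add
      (h1 i (fun x => a x i * v x) ((hv.memLp_four hbd).mul' (ha4 i)))
  refine tendsto_nhds_unique hlim ?_
  refine tendsto_const_nhds.congr fun m => ?_
  rw [← hhalf _ (hψ m)]
  refine Finset.sum_congr rfl fun i _ => ?_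
  congr 1
  · congr 1; ext x; ring
  · congr 1; ext x; ring

theorem memLp_advect (hbd : Bornology.IsBounded Ω) {a b : Plane → Plane}
    (ha : MemV Ω a) (hb : MemV Ω b) (j : Fin 2) :
    MemLp (advect Ω a b j) ((4 / 3 : ℝ≥0) : ℝ≥0∞) (volume.restrict Ω) := by
  refine memLp_finsetSum _ fun i _ => ?_
  exact (((ha.1 i).memLp_four hbd).mul' ((hb.1 j).1.memLp_weakPD i)).ae_eq
    (.of_forall fun x => mul_comm _ _)

theorem fnDist_advect (hbd : Bornology.IsBounded Ω) {a b : Plane → Plane}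
    (ha : MemV Ω a) (hb : MemV Ω b) (j : Fin 2) {w : Plane → ℝ} (hw : MemH10 Ω w) :
    fnDist Ω (advect Ω a b j) w
      = ∑ i : Fin 2, ∫ x in Ω, (a x i * weakPD Ω i (fun y => b y j) x) * w x := by
  unfold fnDist advect
  rw [← integral_finsetSum]
  · congr 1; ext x; rw [Finset.sum_mul]
  · intro i _
    exact integrable_mul ((((ha.1 i).memLp_four hbd).mul' ((hb.1 j).1.memLp_weakPD i)).ae_eq
      (.of_forall fun x => mul_comm _ _) : MemLp _ ((4 / 3 : ℝ≥0) : ℝ≥0∞) _) (hw.memLp_four hbd)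

theorem fnDist_advect_antisymm (hbd : Bornology.IsBounded Ω) {a b c : Plane → Plane}
    (ha : MemV Ω a) (hb : MemV Ω b) (hc : MemV Ω c) (j : Fin 2) :
    fnDist Ω (advect Ω a b j) (fun x => c x j)
      = - fnDist Ω (advect Ω a c j) (fun x => b x j) := by
  have h := integral_advect_add_symm hbd ha (hb.1 j) (hc.1 j)
  rw [Finset.sum_add_distrib] at h
  rw [fnDist_advect hbd ha hb j (hc.1 j), fnDist_advect hbd ha hc j (hb.1 j),
    eq_neg_iff_add_eq_zero, ← h]
  congr 1
  refine Finset.sum_congr rfl fun i _ => ?_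
  congr 1; ext x; ring

theorem fnDist_crossZ_self (z : Plane → ℝ) (w : Plane → Plane) :
    ∑ j : Fin 2, fnDist Ω (crossZ z w j) (fun x => w x j) = 0 := by
  have h : ∫ x in Ω, -(z x * w x 1) * w x 0 = -∫ x in Ω, z x * w x 0 * w x 1 := by
    rw [← integral_neg]
    congr 1; ext x; ring
  simp only [Fin.sum_univ_two, fnDist, crossZ, if_true, one_ne_zero, if_false, h,
    neg_add_cancel]

/-! ### Energy identities -/

/-- The integrated form of `(a - b) a = (a² - b² + (a - b)²) / 2`. -/
theorem integral_sub_mul_self {μ : Measure Plane} {a b : Plane → ℝ} (ha : MemLp a 2 μ)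
    (hb : MemLp b 2 μ) :
    ∫ x, (a x - b x) * a x ∂μ
      = (1 / 2) * ((∫ x, a x ^ 2 ∂μ) - (∫ x, b x ^ 2 ∂μ) + ∫ x, (a x - b x) ^ 2 ∂μ) := by
  have hab : Integrable (fun x => (a x - b x) ^ 2) μ := (ha.sub hb).integrable_sq
  rw [← integral_sub ha.integrable_sq hb.integrable_sq,
    ← integral_add (f := fun x => a x ^ 2 - b x ^ 2)
      (ha.integrable_sq.sub hb.integrable_sq) hab, ← integral_const_mul]
  congr 1; ext x; ring

/-- The Dirichlet form `∫ ∇a · ∇b` of two scalar functions. -/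
noncomputable def dirichletForm (Ω : Set Plane) (a b : Plane → ℝ) : ℝ :=
  ∑ i : Fin 2, ∫ x in Ω, weakPD Ω i a x * weakPD Ω i b x

theorem gradSq_eq_sum_dirichletForm (w : Plane → Plane) :
    gradSq Ω w = ∑ j : Fin 2, dirichletForm Ω (fun x => w x j) (fun x => w x j) := by
  simp only [gradSq, dirichletForm, sq]

theorem dirichletForm_sub_self (hΩ : IsOpen Ω) {a b : Plane → ℝ} (ha : MemH1 Ω a)
    (hb : MemH1 Ω b) :
    dirichletForm Ω (fun x => a x - b x) a
      = (1 / 2) * (dirichletForm Ω a a - dirichletForm Ω b b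
        + dirichletForm Ω (fun x => a x - b x) (fun x => a x - b x)) := by
  unfold dirichletForm
  rw [← Finset.sum_sub_distrib, ← Finset.sum_add_distrib, Finset.mul_sum]
  refine Finset.sum_congr rfl fun i _ => ?_
  have he := (weakPD_sub_ae hΩ ha hb i).2
  have h1 : ∫ x in Ω, weakPD Ω i (fun x => a x - b x) x * weakPD Ω i a x
      = ∫ x in Ω, (weakPD Ω i a x - weakPD Ω i b x) * weakPD Ω i a x :=
    integral_congr_ae (by filter_upwards [he] with x hx; rw [hx])
  have h2 : ∫ x in Ω, weakPD Ω i (fun x => a x - b x) x * weakPD Ω i (fun x => a x - b x) x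
      = ∫ x in Ω, (weakPD Ω i a x - weakPD Ω i b x) ^ 2 :=
    integral_congr_ae (by filter_upwards [he] with x hx; rw [hx, sq])
  rw [h1, h2, integral_sub_mul_self (ha.memLp_weakPD i) (hb.memLp_weakPD i)]
  simp only [sq]

/-- The approximation of `MemH10.exists_approx`, for the distributions of the scheme: each of them
extends by continuity from test functions to `v ∈ H¹₀(Ω)`. -/
theorem MemH10.exists_dist_approx (hbd : Bornology.IsBounded Ω) {v : Plane → ℝ}
    (hv : MemH10 Ω v) : ∃ φ : ℕ → Plane → ℝ, (∀ m, IsTest Ω (φ m)) ∧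
      (∀ g : Plane → ℝ, MemLp g ((4 / 3 : ℝ≥0) : ℝ≥0∞) (volume.restrict Ω) →
        Tendsto (fun m => fnDist Ω g (φ m)) atTop (𝓝 (fnDist Ω g v))) ∧
      (∀ a : Plane → ℝ, MemH1 Ω a →
        Tendsto (fun m => lapDist Ω a (φ m)) atTop (𝓝 (-dirichletForm Ω a v))) ∧
      ∀ (j : Fin 2) (q : Plane → ℝ), MemL2 Ω q →
        Tendsto (fun m => gradDist Ω q j (φ m)) atTop
          (𝓝 (-∫ x in Ω, q x * weakPD Ω j v x)) := by
  obtain ⟨φ, hφ, h0, h1⟩ := hv.exists_approx hbd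
  refine ⟨φ, hφ, h0, fun a ha => ?_, fun j q hq => (h1 j q hq).neg⟩
  exact (tendsto_finsetSum Finset.univ fun i _ => h1 i _ (ha.memLp_weakPD i)).neg

theorem memLp_fourThirds (hbd : Bornology.IsBounded Ω) {g : Plane → ℝ} (hg : MemL2 Ω g) :
    MemLp g ((4 / 3 : ℝ≥0) : ℝ≥0∞) (volume.restrict Ω) := by
  have := isFiniteMeasure_restrict hbd
  refine MemLp.mono_exponent hg ?_
  rw [show (2 : ℝ≥0∞) = ((2 : ℝ≥0) : ℝ≥0∞) by rfl, ENNReal.coe_le_coe, ← NNReal.coe_le_coe]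
  push_cast
  norm_num

theorem memLp_crossZ (hbd : Bornology.IsBounded Ω) {z : Plane → ℝ} {w : Plane → Plane}
    (hz : MemL2 Ω z) (hw : MemV Ω w) (j : Fin 2) :
    MemLp (crossZ z w j) ((4 / 3 : ℝ≥0) : ℝ≥0∞) (volume.restrict Ω) := by
  have h : ∀ i, MemLp (fun x => z x * w x i) ((4 / 3 : ℝ≥0) : ℝ≥0∞) (volume.restrict Ω) :=
    fun i => ((hw.1 i).memLp_four hbd).mul' hz
  fin_cases j
  · simpa [crossZ] using! (h 1).neg
  · simpa [crossZ] using! h 0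

theorem memL2_norm_sq (hbd : Bornology.IsBounded Ω) {w : Plane → Plane} (hw : MemV Ω w) :
    MemL2 Ω (fun x => ‖w x‖ ^ 2) := by
  have h : MemL2 Ω (fun x => ∑ j : Fin 2, w x j * w x j) :=
    memLp_finsetSum _ fun j _ => ((hw.1 j).memLp_four hbd).mul' ((hw.1 j).memLp_four hbd)
  refine h.ae_eq (.of_forall fun x => ?_)
  simp only [EuclideanSpace.norm_sq_eq, Real.norm_eq_abs, sq_abs, sq (w x _)]

/-- The equation of the velocity, tested with the new velocity `U`. The factor `c` is `1 / k`; the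
term `z × U` and the pressure drop out, and the work of `(H · ∇) H` on `U` remains. -/
theorem integral_velocity_eq (hΩ : IsOpen Ω) (hbd : Bornology.IsBounded Ω) {c α ν : ℝ}
    {u U H F : Plane → Plane} {z q : Plane → ℝ} (hu : MemV Ω u) (hU : MemV Ω U)
    (hH : MemV Ω H) (hF : ∀ j, MemL2 Ω (fun x => F x j)) (hz : MemL2 Ω z) (hq : MemL2 Ω q)
    (heq : ∀ j : Fin 2, ∀ φ : Plane → ℝ, IsTest Ω φ →
      c * fnDist Ω (fun x => U x j - u x j) φ
        - α * c * lapDist Ω (fun x => U x j - u x j) φ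
        - ν * lapDist Ω (fun x => U x j) φ
        + fnDist Ω (crossZ z U j) φ
      = fnDist Ω (fun x => F x j) φ + fnDist Ω (advect Ω H H j) φ - gradDist Ω q j φ) :
    c * (l2Sq Ω U - l2Sq Ω u + l2Sq Ω (U - u)) / 2
      + α * c * (gradSq Ω U - gradSq Ω u + gradSq Ω (U - u)) / 2 + ν * gradSq Ω U
      = ∑ j : Fin 2, fnDist Ω (fun x => F x j) (fun x => U x j)
        + ∑ j : Fin 2, fnDist Ω (advect Ω H H j) (fun x => U x j) := by
  have hlim : ∀ j : Fin 2,
      c * fnDist Ω (fun x => U x j - u x j) (fun x => U x j)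
        + α * c * dirichletForm Ω (fun x => U x j - u x j) (fun x => U x j)
        + ν * dirichletForm Ω (fun x => U x j) (fun x => U x j)
        + fnDist Ω (crossZ z U j) (fun x => U x j)
      = fnDist Ω (fun x => F x j) (fun x => U x j)
        + fnDist Ω (advect Ω H H j) (fun x => U x j)
        + ∫ x in Ω, q x * weakPD Ω j (fun y => U y j) x := by
    intro j
    obtain ⟨φ, hφ, h0, h1, h2⟩ := (hU.1 j).exists_dist_approx hbd
    have hsub := (weakPD_sub_ae hΩ (hU.1 j).1 (hu.1 j).1 j).1
    have hl := ((((h0 _ (memLp_fourThirds hbd hsub.1)).const_mul c).sub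
      ((h1 _ hsub).const_mul (α * c))).sub ((h1 _ (hU.1 j).1).const_mul ν)).add
      (h0 _ (memLp_crossZ hbd hz hU j))
    have hr := ((h0 _ (memLp_fourThirds hbd (hF j))).add
      (h0 _ (memLp_advect hbd hH hH j))).sub (h2 j q hq)
    have := tendsto_nhds_unique (hl.congr fun m => heq j _ (hφ m)) hr
    linarith
  have hsum := Finset.sum_congr (rfl : Finset.univ = Finset.univ) fun j _ => hlim j
  simp only [Finset.sum_add_distrib, ← Finset.mul_sum] at hsum
  rw [fnDist_crossZ_self, integral_mul_weakDiv hq hU] at hsum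
  simp only [fnDist, integral_sub_mul_self (hU.1 _).1.1 (hu.1 _).1.1,
    dirichletForm_sub_self hΩ (hU.1 _).1 (hu.1 _).1] at hsum
  simp only [Finset.sum_add_distrib, Finset.sum_sub_distrib, ← Finset.mul_sum] at hsum
  rw [l2Sq_eq_sum fun j => (hU.1 j).1.1, l2Sq_eq_sum fun j => (hu.1 j).1.1,
    l2Sq_eq_sum (w := U - u) fun j => (hU.1 j).1.1.sub (hu.1 j).1.1]
  simp only [gradSq_eq_sum_dirichletForm]
  simp only [fnDist]
  simp only [Pi.sub_apply, PiLp.sub_apply]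
  linarith

/-- The equation of the magnetic field, tested with the new field `H`. The transport of `H` by `U`
drops out and the stretching term becomes the work of `(H · ∇) H` on `U`, with the sign opposite to
that in the equation of the velocity. -/
theorem integral_magnetic_eq (hΩ : IsOpen Ω) (hbd : Bornology.IsBounded Ω) {c : ℝ}
    {U h H : Plane → Plane} {r : Plane → ℝ} (hh : MemV Ω h) (hU : MemV Ω U)
    (hH : MemV Ω H) (hr : MemL2 Ω r)
    (heq : ∀ j : Fin 2, ∀ φ : Plane → ℝ, IsTest Ω φ →
      c * fnDist Ω (fun x => H x j - h x j) φ
        - lapDist Ω (fun x => H x j) φ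
        + fnDist Ω (advect Ω U H j) φ - fnDist Ω (advect Ω H U j) φ
      = - gradDist Ω r j φ) :
    c * (l2Sq Ω H - l2Sq Ω h + l2Sq Ω (H - h)) / 2 + gradSq Ω H
      + ∑ j : Fin 2, fnDist Ω (advect Ω H H j) (fun x => U x j) = 0 := by
  have hlim : ∀ j : Fin 2,
      c * fnDist Ω (fun x => H x j - h x j) (fun x => H x j)
        + dirichletForm Ω (fun x => H x j) (fun x => H x j)
        + fnDist Ω (advect Ω H H j) (fun x => U x j)
      = ∫ x in Ω, r x * weakPD Ω j (fun y => H y j) x := by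
    intro j
    obtain ⟨φ, hφ, h0, h1, h2⟩ := (hH.1 j).exists_dist_approx hbd
    have hsub := (weakPD_sub_ae hΩ (hH.1 j).1 (hh.1 j).1 j).1
    have hl := ((((h0 _ (memLp_fourThirds hbd hsub.1)).const_mul c).sub
      (h1 _ (hH.1 j).1)).add (h0 _ (memLp_advect hbd hU hH j))).sub
      (h0 _ (memLp_advect hbd hH hU j))
    have := tendsto_nhds_unique (hl.congr fun m => heq j _ (hφ m)) (h2 j r hr).neg
    have e1 := fnDist_advect_antisymm hbd hU hH hH j
    have e2 := fnDist_advect_antisymm hbd hH hU hH j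
    linarith
  have hsum := Finset.sum_congr (rfl : Finset.univ = Finset.univ) fun j _ => hlim j
  simp only [Finset.sum_add_distrib, ← Finset.mul_sum] at hsum
  rw [integral_mul_weakDiv hr hH] at hsum
  simp only [fnDist, integral_sub_mul_self (hH.1 _).1.1 (hh.1 _).1.1] at hsum
  simp only [Finset.sum_add_distrib, Finset.sum_sub_distrib, ← Finset.mul_sum] at hsum
  rw [l2Sq_eq_sum fun j => (hH.1 j).1.1, l2Sq_eq_sum fun j => (hh.1 j).1.1,
    l2Sq_eq_sum (w := H - h) fun j => (hH.1 j).1.1.sub (hh.1 j).1.1,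
    gradSq_eq_sum_dirichletForm]
  simp only [fnDist]
  simp only [Pi.sub_apply, PiLp.sub_apply]
  linarith

/-- Young's and Poincaré's inequalities: the dissipation absorbs the work of the force. -/
theorem sum_fnDist_le {C ν : ℝ} (hC : 0 < C) (hν : 0 < ν) {F U : Plane → Plane}
    (hF : ∀ j, MemL2 Ω (fun x => F x j)) (hU : ∀ j, MemL2 Ω (fun x => U x j))
    (hP : l2Sq Ω U ≤ C ^ 2 * gradSq Ω U) :
    ∑ j : Fin 2, fnDist Ω (fun x => F x j) (fun x => U x j)
      ≤ C ^ 2 / (4 * ν) * l2Sq Ω F + ν * gradSq Ω U := by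
  have h1 : ∑ j : Fin 2, fnDist Ω (fun x => F x j) (fun x => U x j)
      ≤ C ^ 2 / (4 * ν) * l2Sq Ω F + ν / C ^ 2 * l2Sq Ω U := by
    rw [l2Sq_eq_sum hF, l2Sq_eq_sum hU, Finset.mul_sum, Finset.mul_sum,
      ← Finset.sum_add_distrib]
    refine Finset.sum_le_sum fun j _ => ?_
    rw [← integral_const_mul, ← integral_const_mul,
      ← integral_add ((hF j).integrable_sq.const_mul _) ((hU j).integrable_sq.const_mul _)]
    refine integral_mono (integrable_mul (hF j) (hU j))
      (((hF j).integrable_sq.const_mul _).add ((hU j).integrable_sq.const_mul _)) fun x => ?_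
    have hsq : C ^ 2 / (4 * ν) * F x j ^ 2 + ν / C ^ 2 * U x j ^ 2 - F x j * U x j
        = C ^ 2 / (4 * ν) * (F x j - 2 * ν / C ^ 2 * U x j) ^ 2 := by
      field_simp
      ring
    have : 0 ≤ C ^ 2 / (4 * ν) * (F x j - 2 * ν / C ^ 2 * U x j) ^ 2 := by positivity
    change F x j * U x j ≤ C ^ 2 / (4 * ν) * F x j ^ 2 + ν / C ^ 2 * U x j ^ 2
    linarith
  have h2 : ν / C ^ 2 * l2Sq Ω U ≤ ν * gradSq Ω U := by
    calc ν / C ^ 2 * l2Sq Ω U ≤ ν / C ^ 2 * (C ^ 2 * gradSq Ω U) := by gcongr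
      _ = _ := by field_simp
  linarith

theorem gradSq_nonneg (w : Plane → Plane) : 0 ≤ gradSq Ω w :=
  Finset.sum_nonneg fun _ _ => Finset.sum_nonneg fun _ _ => integral_nonneg fun _ => sq_nonneg _

theorem l2Sq_nonneg (w : Plane → Plane) : 0 ≤ l2Sq Ω w :=
  integral_nonneg fun _ => sq_nonneg _

/-! ### Averages in time -/

/-- The Cauchy–Schwarz inequality for the average over a set of measure `k`. If `g` is not
integrable, its integral has the value `0` and the bound is trivial, so no measurability is assumed. -/
theorem sq_norm_integral_le {k : ℝ} (hk : 0 < k) {μ : Measure ℝ} [IsFiniteMeasure μ]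
    (hμ : μ.real Set.univ = k) {g : ℝ → Plane} (hg : Integrable (fun s => ‖g s‖ ^ 2) μ) :
    ‖(1 / k) • ∫ s, g s ∂μ‖ ^ 2 ≤ (1 / k) * ∫ s, ‖g s‖ ^ 2 ∂μ := by
  have h0 : 0 ≤ ∫ s, ‖g s‖ ^ 2 ∂μ := integral_nonneg fun _ => sq_nonneg _
  by_cases hi : Integrable g μ
  · have h1 : ‖(1 / k) • ∫ s, g s ∂μ‖ ≤ (1 / k) * ∫ s, ‖g s‖ ∂μ := by
      rw [norm_smul, Real.norm_of_nonneg (by positivity)]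
      gcongr
      exact norm_integral_le_integral_norm _
    -- With `c` the average of `‖g‖`, the inequality is `0 ≤ ∫ (‖g‖ - c)²`.
    set c := (1 / k) * ∫ s, ‖g s‖ ∂μ with hc
    have hIc : ∫ s, ‖g s‖ ∂μ = k * c := by rw [hc]; field_simp
    have h2 : 0 ≤ ∫ s, (‖g s‖ - c) ^ 2 ∂μ := integral_nonneg fun _ => sq_nonneg _
    have h3 : ∫ s, (‖g s‖ - c) ^ 2 ∂μ = (∫ s, ‖g s‖ ^ 2 ∂μ) - 2 * c * (k * c) + c ^ 2 * k := by
      calc ∫ s, (‖g s‖ - c) ^ 2 ∂μ = ∫ s, ((‖g s‖ ^ 2 - 2 * c * ‖g s‖) + c ^ 2) ∂μ := by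
            congr 1; ext s; ring
        _ = _ := by
            rw [integral_add (f := fun s => ‖g s‖ ^ 2 - 2 * c * ‖g s‖)
              (hg.sub (hi.norm.const_mul _)) (integrable_const _),
              integral_sub hg (hi.norm.const_mul _), integral_const_mul, hIc,
              integral_const, hμ, smul_eq_mul]
            ring
    have h4 : c ^ 2 ≤ (1 / k) * ∫ s, ‖g s‖ ^ 2 ∂μ := by
      rw [one_div, ← div_eq_inv_mul, le_div_iff₀ hk]
      nlinarith
    exact (pow_le_pow_left₀ (norm_nonneg _) h1 2).trans h4
  · rw [integral_undef hi, smul_zero, norm_zero, zero_pow two_ne_zero]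
    positivity

/-- The average of `f` over a time interval of length `k` is in `L²(Ω)²`, and `k` times its squared
norm is at most the squared norm of `f` on the corresponding cylinder. -/
theorem timeAvg_bound {T k : ℝ} (hk : 0 < k) {f : ℝ × Plane → Plane}
    (hf : MemLp f 2 (volume.restrict (Set.Ioo 0 T ×ˢ Ω))) {n : ℕ} (hn : ((n : ℝ) + 1) * k ≤ T) :
    (∀ j, MemL2 Ω (fun x => timeAvg f k (n + 1) x j)) ∧
      k * l2Sq Ω (timeAvg f k (n + 1))
        ≤ ∫ y in Set.Ioo (n * k) ((n + 1) * k) ×ˢ Ω, ‖f y‖ ^ 2 := by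
  have hsub : Set.Ioo (n * k) ((n + 1) * k) ×ˢ Ω ⊆ Set.Ioo 0 T ×ˢ Ω :=
    Set.prod_mono (Set.Ioo_subset_Ioo (by positivity) hn) subset_rfl
  have hf' := hf.mono_measure (Measure.restrict_mono_set volume hsub)
  rw [Measure.volume_eq_prod, ← Measure.prod_restrict] at hf' ⊢
  have hle : (n : ℝ) * k ≤ (n + 1) * k := by nlinarith
  have hlen : (volume.restrict (Set.Ioo (n * k) ((n + 1) * k))).real Set.univ = k := by
    rw [measureReal_restrict_apply_univ, Real.volume_real_Ioo_of_le hle]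
    ring
  have havg : ∀ x, timeAvg f k (n + 1) x
      = (1 / k) • ∫ s in Set.Ioo (n * k) ((n + 1) * k), f (s, x) := by
    intro x
    unfold timeAvg
    push_cast
    rw [add_sub_cancel_right, intervalIntegral.integral_of_le hle, integral_Ioc_eq_integral_Ioo]
  have hsq : Integrable (fun y => ‖f y‖ ^ 2) ((volume.restrict (Set.Ioo (n * k) ((n + 1) * k))).prod
      (volume.restrict Ω)) := (memLp_two_iff_integrable_sq_norm hf'.1).1 hf'
  have hmeas : AEStronglyMeasurable (timeAvg f k (n + 1)) (volume.restrict Ω) := by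
    have := (hf'.1.prod_swap.integral_prod_right').const_smul (1 / k)
    exact this.congr (.of_forall fun x => (havg x).symm)
  have hpt : ∀ᵐ x ∂(volume.restrict Ω), ‖timeAvg f k (n + 1) x‖ ^ 2
      ≤ (1 / k) * ∫ s in Set.Ioo (n * k) ((n + 1) * k), ‖f (s, x)‖ ^ 2 := by
    filter_upwards [hsq.prod_left_ae] with x hx
    rw [havg]
    exact sq_norm_integral_le hk hlen hx
  have hdom := hsq.integral_prod_right.const_mul (1 / k)
  have hint : Integrable (fun x => ‖timeAvg f k (n + 1) x‖ ^ 2) (volume.restrict Ω) := by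
    refine hdom.mono' (hmeas.norm.pow 2) ?_
    filter_upwards [hpt] with x hx
    rwa [Real.norm_of_nonneg (sq_nonneg _)]
  have hmem := (memLp_two_iff_integrable_sq_norm hmeas).2 hint
  refine ⟨fun j => hmem.eval_piLp j, ?_⟩
  have := integral_mono_ae hint hdom hpt
  rw [integral_const_mul, ← integral_prod_symm _ hsq] at this
  unfold l2Sq
  calc k * ∫ x in Ω, ‖timeAvg f k (n + 1) x‖ ^ 2 ≤ k * (1 / k * _) := by gcongr
    _ = _ := by rw [← mul_assoc, mul_one_div_cancel hk.ne', one_mul]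

/-! ### The discrete energy estimate -/

/-- The energy balance of a single time interval. -/
theorem IsScheme.energy_step (hΩ : IsOpen Ω) (hbd : Bornology.IsBounded Ω) {C : ℝ} (hC : 0 < C)
    (hP : ∀ w : Plane → Plane, (∀ j, MemH10 Ω (fun x => w x j)) →
      l2Sq Ω w ≤ C ^ 2 * gradSq Ω w)
    {α ν T : ℝ} (hν : 0 < ν) (hT : 0 < T) {f : ℝ × Plane → Plane}
    (hf : MemLp f 2 (volume.restrict (Set.Ioo 0 T ×ˢ Ω)))
    {u₀ h₀ : Plane → Plane} (hu₀ : MemV Ω u₀) (hh₀ : MemV Ω h₀) {N : ℕ}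
    {u h : ℕ → Plane → Plane} {z p r : ℕ → Plane → ℝ}
    (hS : IsScheme Ω α ν T N f u₀ h₀ u h z p r) {n : ℕ} (hn : n < N) :
    alphaSq Ω α (u (n + 1)) + alphaSq Ω α (u (n + 1) - u n)
        + l2Sq Ω (h (n + 1)) + l2Sq Ω (h (n + 1) - h n)
      ≤ C ^ 2 / (2 * ν) *
          (∫ y in Set.Ioo (n * (T / N)) ((n + 1) * (T / N)) ×ˢ Ω, ‖f y‖ ^ 2)
        + alphaSq Ω α (u n) + l2Sq Ω (h n) := by
  have hN : (0 : ℝ) < N := by exact_mod_cast (Nat.zero_le n).trans_lt hn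
  have hk : 0 < T / N := div_pos hT hN
  have hnT : ((n : ℝ) + 1) * (T / N) ≤ T := by
    have : (n : ℝ) + 1 ≤ N := by exact_mod_cast hn
    calc ((n : ℝ) + 1) * (T / N) ≤ N * (T / N) := by gcongr
      _ = T := by field_simp
  have hu : MemV Ω (u n) := by
    rcases n with _ | m
    · rwa [hS.u_zero]
    · exact hS.u_mem m (by omega)
  have hh : MemV Ω (h n) := by
    rcases n with _ | m
    · rwa [hS.h_zero]
    · exact hS.h_mem m (by omega)
  have hz : MemL2 Ω (z n) := by
    rcases n with _ | m
    · exact hS.z_zero_mem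
    · exact hS.z_mem m (by omega)
  obtain ⟨hF, hFle⟩ := timeAvg_bound hk hf hnT
  have hU := hS.u_mem n hn
  have hH := hS.h_mem n hn
  have e1 := integral_velocity_eq hΩ hbd hu hU hH hF hz
    ((hS.p_mem n hn).1.add (memL2_norm_sq hbd hH)) (hS.eq_u n hn)
  have e2 := integral_magnetic_eq hΩ hbd hh hU hH (hS.r_mem n hn).1 (hS.eq_h n hn)
  -- Adding `e1` and `e2` cancels the work of `(H · ∇) H` on `U`.
  have e3 := sum_fnDist_le hC hν hF (fun j => (hU.1 j).1.1) (hP _ hU.1)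
  have e4 := gradSq_nonneg (Ω := Ω) (h (n + 1))
  set k := T / N
  have e5 : C ^ 2 / (2 * ν) * (k * l2Sq Ω (timeAvg f k (n + 1))) ≤ C ^ 2 / (2 * ν) *
      (∫ y in Set.Ioo (n * k) ((n + 1) * k) ×ˢ Ω, ‖f y‖ ^ 2) := by gcongr
  unfold alphaSq
  set X := l2Sq Ω (u (n + 1)) - l2Sq Ω (u n) + l2Sq Ω (u (n + 1) - u n)
  set Y := gradSq Ω (u (n + 1)) - gradSq Ω (u n) + gradSq Ω (u (n + 1) - u n)
  set Z := l2Sq Ω (h (n + 1)) - l2Sq Ω (h n) + l2Sq Ω (h (n + 1) - h n)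
  have e6 : 1 / k * X / 2 + α * (1 / k) * Y / 2 + 1 / k * Z / 2
      ≤ C ^ 2 / (4 * ν) * l2Sq Ω (timeAvg f k (n + 1)) := by linarith
  have e7 : X + α * Y + Z ≤ C ^ 2 / (2 * ν) * (k * l2Sq Ω (timeAvg f k (n + 1))) := by
    calc X + α * Y + Z = 2 * k * (1 / k * X / 2 + α * (1 / k) * Y / 2 + 1 / k * Z / 2) := by
          field_simp
      _ ≤ 2 * k * (C ^ 2 / (4 * ν) * l2Sq Ω (timeAvg f k (n + 1))) := by gcongr
      _ = _ := by field_simp; ring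
  simp only [X, Y, Z] at e7
  linarith

theorem IsScheme.energy_estimate (hΩ : IsOpen Ω) (hbd : Bornology.IsBounded Ω) {C : ℝ}
    (hC : 0 < C)
    (hP : ∀ w : Plane → Plane, (∀ j, MemH10 Ω (fun x => w x j)) →
      l2Sq Ω w ≤ C ^ 2 * gradSq Ω w)
    {α ν T : ℝ} (hν : 0 < ν) (hT : 0 < T) {f : ℝ × Plane → Plane}
    (hf : MemLp f 2 (volume.restrict (Set.Ioo 0 T ×ˢ Ω)))
    {u₀ h₀ : Plane → Plane} (hu₀ : MemV Ω u₀) (hh₀ : MemV Ω h₀) {N : ℕ}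
    {u h : ℕ → Plane → Plane} {z p r : ℕ → Plane → ℝ}
    (hS : IsScheme Ω α ν T N f u₀ h₀ u h z p r) (n : ℕ) (hn : n ≤ N) :
    alphaSq Ω α (u n) + ∑ i ∈ Finset.range n, alphaSq Ω α (u (i + 1) - u i)
        + (l2Sq Ω (h n) + ∑ i ∈ Finset.range n, l2Sq Ω (h (i + 1) - h i))
      ≤ C ^ 2 / (2 * ν) * (∫ y in Set.Ioo 0 ((n : ℝ) * (T / N)) ×ˢ Ω, ‖f y‖ ^ 2)
        + alphaSq Ω α u₀ + l2Sq Ω h₀ := by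
  induction n with
  | zero => simp [hS.u_zero, hS.h_zero]
  | succ n ih =>
    have hstep := hS.energy_step hΩ hbd hC hP hν hT hf hu₀ hh₀ hn
    have ih := ih (by omega)
    rw [Finset.sum_range_succ, Finset.sum_range_succ]
    have hN : (0 : ℝ) < N := by exact_mod_cast (Nat.zero_le n).trans_lt hn
    have hk : 0 < T / N := div_pos hT hN
    have hnT : ((n : ℝ) + 1) * (T / N) ≤ T := by
      have : (n : ℝ) + 1 ≤ N := by exact_mod_cast hn
      calc ((n : ℝ) + 1) * (T / N) ≤ N * (T / N) := by gcongr
        _ = T := by field_simp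
    set k := T / N
    have hnk : (n : ℝ) * k ≤ (n + 1) * k := by nlinarith
    have hnk0 : 0 ≤ (n : ℝ) * k := by positivity
    have hsq : IntegrableOn (fun y => ‖f y‖ ^ 2) (Set.Ioo 0 T ×ˢ Ω) :=
      (memLp_two_iff_integrable_sq_norm hf.1).1 hf
    have hset : Set.Ioo 0 (n * k) ×ˢ Ω ∪ Set.Ioo (n * k) ((n + 1) * k) ×ˢ Ω
        ⊆ Set.Ioo 0 ((n + 1) * k) ×ˢ Ω :=
      Set.union_subset (Set.prod_mono (Set.Ioo_subset_Ioo_right hnk) subset_rfl)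
        (Set.prod_mono (Set.Ioo_subset_Ioo_left hnk0) subset_rfl)
    have hbig : IntegrableOn (fun y => ‖f y‖ ^ 2) (Set.Ioo 0 ((n + 1) * k) ×ˢ Ω) :=
      hsq.mono_set (Set.prod_mono (Set.Ioo_subset_Ioo_right hnT) subset_rfl)
    have hdisj : Disjoint (Set.Ioo 0 (n * k) ×ˢ Ω) (Set.Ioo (n * k) ((n + 1) * k) ×ˢ Ω) := by
      refine Set.disjoint_left.2 fun y hy hy' => ?_
      exact lt_asymm hy.1.2 hy'.1.1
    have hint : (∫ y in Set.Ioo 0 (n * k) ×ˢ Ω, ‖f y‖ ^ 2)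
        + (∫ y in Set.Ioo (n * k) ((n + 1) * k) ×ˢ Ω, ‖f y‖ ^ 2)
        ≤ ∫ y in Set.Ioo 0 ((n + 1) * k) ×ˢ Ω, ‖f y‖ ^ 2 := by
      rw [← setIntegral_union hdisj (measurableSet_Ioo.prod hΩ.measurableSet)
        (hbig.mono_set (Set.subset_union_left.trans hset))
        (hbig.mono_set (Set.subset_union_right.trans hset))]
      exact setIntegral_mono_set hbig (.of_forall fun _ => sq_nonneg _) hset.eventuallyLE
    have hmul := mul_le_mul_of_nonneg_left hint (show 0 ≤ C ^ 2 / (2 * ν) by positivity)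
    rw [mul_add] at hmul
    push_cast
    linarith

end GradeTwoMHD

theorem proposition6 (Ω : Set GradeTwoMHD.Plane) (hΩ : IsOpen Ω)
    (hbd : Bornology.IsBounded Ω) :
    ∃ C : ℝ, 0 < C ∧
      ∀ (α ν T : ℝ), 0 ≤ α → 0 < ν → 0 < T →
      ∀ (f : ℝ × GradeTwoMHD.Plane → GradeTwoMHD.Plane), GradeTwoMHD.MemL2Hcurl Ω T f →
      ∀ (u₀ h₀ : GradeTwoMHD.Plane → GradeTwoMHD.Plane),
        GradeTwoMHD.MemV Ω u₀ → GradeTwoMHD.MemV Ω h₀ →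
      ∀ (N : ℕ) (u h : ℕ → GradeTwoMHD.Plane → GradeTwoMHD.Plane)
        (z p r : ℕ → GradeTwoMHD.Plane → ℝ),
        GradeTwoMHD.IsScheme Ω α ν T N f u₀ h₀ u h z p r →
      ∀ n : ℕ, 1 ≤ n → n ≤ N →
        (GradeTwoMHD.alphaSq Ω α (u n)
            + ∑ i ∈ Finset.range n, GradeTwoMHD.alphaSq Ω α (u (i + 1) - u i)
          ≤ C ^ 2 / (2 * ν) *
                (∫ y in Set.Ioo 0 ((n : ℝ) * (T / N)) ×ˢ Ω, ‖f y‖ ^ 2)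
              + GradeTwoMHD.alphaSq Ω α u₀ + GradeTwoMHD.l2Sq Ω h₀) ∧
        (GradeTwoMHD.l2Sq Ω (h n)
            + ∑ i ∈ Finset.range n, GradeTwoMHD.l2Sq Ω (h (i + 1) - h i)
          ≤ C ^ 2 / (2 * ν) *
                (∫ y in Set.Ioo 0 ((n : ℝ) * (T / N)) ×ˢ Ω, ‖f y‖ ^ 2)
              + GradeTwoMHD.alphaSq Ω α u₀ + GradeTwoMHD.l2Sq Ω h₀) := by

  obtain ⟨C, hC, hP⟩ := GradeTwoMHD.exists_poincare hbd
  refine ⟨C, hC, fun α ν T hα hν hT f hf u₀ h₀ hu₀ hh₀ N u h z p r hS n _ hn => ?_⟩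
  have hE := hS.energy_estimate hΩ hbd hC hP hν hT hf.1 hu₀ hh₀ n hn
  have hα_nonneg : ∀ w, 0 ≤ GradeTwoMHD.alphaSq Ω α w := fun w =>
    add_nonneg (GradeTwoMHD.l2Sq_nonneg w) (mul_nonneg hα (GradeTwoMHD.gradSq_nonneg w))
  have h1 := Finset.sum_nonneg fun i (_ : i ∈ Finset.range n) => hα_nonneg (u (i + 1) - u i)
  have h2 := Finset.sum_nonneg fun i (_ : i ∈ Finset.range n) =>
    GradeTwoMHD.l2Sq_nonneg (Ω := Ω) (h (i + 1) - h i)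
  have h3 := hα_nonneg (u n)
  have h4 := GradeTwoMHD.l2Sq_nonneg (Ω := Ω) (h n)
  exact ⟨by linarith, by linarith⟩
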